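/- Let $\mathcal A$ be a unital $C^*$-algebra and let $H_{\mathcal A}$ be the standard Hilbert $\mathcal A$-module, i.e. the left $\mathcal A$-module of all sequences $x=(x_k)_{k\in\mathbb N}$ in $\mathcal A$ for which $\sum_k x_kx_k^*$ converges in norm, with inner product $\langle x,y\rangle=\sum_k y_kx_k^*$ and norm $\|x\|=\|\langle x,x\rangle\|^{1/2}$. (Taking adjoints entrywise turns this into the right-module picture.) Let $B^a(H_{\mathcal A})$ be the set of bounded adjointable operators on $H_{\mathcal A}$, and let $F^*$ denote the adjoint of $F$. For $F\in B^a(H_{\mathcal A})$, a *diagonal decomposition* $(M_1,N_1,M_2,N_2)$ of $F$ consists of closed submodules of $H_{\mathcal A}$ such that $H_{\mathcal A}=M_1\,\tilde\oplus\,N_1=M_2\,\tilde\oplus\,N_2$ (direct sums, not necessarily orthogonal), $F$ restricts to an isomorphism of $M_1$ onto $M_2$, and $F(N_1)\subseteq N_2$. Here an isomorphism is a bounded $\mathcal A$-linear bijection with bounded inverse. A submodule is finitely generated if it is the $\mathcal A$-linear span of a finite set, and $N\preceq N'$ means that $N$ is isomorphic to a closed submodule of $N'$. Define the following classes of operators $F\in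 B^a(H_{\mathcal A})$: - $\mathcal M\Phi_+$ (respectively $\mathcal M\Phi_-$, $\mathcal M\Phi$): $F$ has a diagonal decomposition with $N_1$ (respectively $N_2$, both $N_1$ and $N_2$) finitely generated. - ${\mathcal M\Phi_+^-}'$: $F\in\mathcal M\Phi_+$ and $F$ has a diagonal decomposition with $N_1$ finitely generated and $N_1\preceq N_2$. - ${\mathcal M\Phi_-^+}'$: $F\in\mathcal M\Phi_-$ and $F$ has a diagonal decomposition with $N_2$ finitely generated and $N_2\preceq N_1$. - $\widetilde{\mathcal M\Phi}{}_+^-$ (respectively $\widetilde{\mathcal M\Phi}{}_-^+$): $F\in\mathcal M\Phi$ and $F$ has a diagonal decomposition with $N_1,N_2$ finitely generated and $N_1\preceq N_2$ (respectively $N_2\preceq N_1$). - $\mathcal M\Phi_+^-=\widetilde{\mathcal M\Phi}{}_+^-\cup(\mathcal M\Phi_+\setminus\mathcal M\Phi)$ and $\mathcal M\Phi_-^+=\widetilde{\mathcal M\Phi}{}_-^+\cup(\mathcal M\Phi_-\setminus\mathcal M\Phi)$. Then for every $F\in B^a(H_{\mathcal A})$: 1. $F\in{\mathcal M\Phi_+^-}'$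 if and only if $F^*\in{\mathcal M\Phi_-^+}'$; 2. $F\in\widetilde{\mathcal M\Phi}{}_+^-$ if and only if $F^*\in\widetilde{\mathcal M\Phi}{}_-^+$; 3. $F\in\mathcal M\Phi_+^-$ if and only if $F^*\in\mathcal M\Phi_-^+$. -/

import Mathlib

open scoped InnerProductSpace

noncomputable section

/-! Hilbert `C⋆`-modules follow Mathlib's `CStarModule` convention: the algebra acts on the left and
the inner product is `A`-linear in its second variable and conjugate linear in its first one. -/

/-! ### The standard Hilbert module over a unital `C⋆`-algebra -/

section Standard

variable {A : Type*} [CStarAlgebra A]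

/-- Comparison test for series of positive elements of a `C⋆`-algebra. -/
theorem summable_of_nonneg_of_le_cstar [PartialOrder A] [StarOrderedRing A] {f g : ℕ → A}
    (hf : ∀ k, 0 ≤ f k) (hfg : ∀ k, f k ≤ g k) (hg : Summable g) : Summable f := by
  rw [summable_iff_vanishing_norm] at hg ⊢
  intro ε hε
  obtain ⟨s, hs⟩ := hg ε hε
  refine ⟨s, fun t ht => lt_of_le_of_lt ?_ (hs t ht)⟩
  exact CStarAlgebra.norm_le_norm_of_nonneg_of_le (Finset.sum_nonneg fun k _ => hf k)
    (Finset.sum_le_sum fun k _ => hfg k)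

theorem summable_add_mul_star {x y : ℕ → A} (hx : Summable fun k => x k * star (x k))
    (hy : Summable fun k => y k * star (y k)) :
    Summable fun k => (x k + y k) * star (x k + y k) := by
  let _ : PartialOrder A := CStarAlgebra.spectralOrder A
  have _ : StarOrderedRing A := CStarAlgebra.spectralOrderedRing A
  refine summable_of_nonneg_of_le_cstar (fun k => mul_star_self_nonneg _) (fun k => ?_)
    ((hx.add hy).add (hx.add hy))
  have h : 0 ≤ (x k - y k) * star (x k - y k) := mul_star_self_nonneg _
  rw [← sub_nonneg]
  convert h using 1
  simp only [star_add, star_sub]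
  noncomm_ring

theorem summable_smul_mul_star (a : A) {x : ℕ → A} (hx : Summable fun k => x k * star (x k)) :
    Summable fun k => (a * x k) * star (a * x k) := by
  have h := (hx.mul_left a).mul_right (star a)
  simpa only [star_mul, mul_assoc] using h

theorem summable_mul_star {x y : ℕ → A} (hx : Summable fun k => x k * star (x k))
    (hy : Summable fun k => y k * star (y k)) : Summable fun k => y k * star (x k) := by
  have key : ∀ c : ℂ, Summable fun k => (y k + c • x k) * star (y k + c • x k) := by
    intro c
    refine summable_add_mul_star hy ?_
    simpa only [smul_mul_assoc, one_mul] using summable_smul_mul_star (c • (1 : A)) hx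
  have h := (((key 1).sub (key (-1))).add (((key Complex.I).sub (key (-Complex.I))).const_smul
    Complex.I)).const_smul ((1 / 4 : ℂ))
  refine h.congr fun k => ?_
  simp only [star_add, star_smul, mul_add, add_mul, smul_mul_assoc, mul_smul_comm, smul_smul,
    smul_add, smul_sub, RCLike.star_def, map_neg, map_one, Complex.conj_I]
  match_scalars <;> simp <;> norm_num

/-- The sequences `(x k)` in `A` for which `∑ x k (x k)⋆` converges in norm. The terms are positive,
so convergence of the partial sums and unconditional convergence are the same. -/
def standardSubmodule (A : Type*) [CStarAlgebra A] : Submodule A (ℕ → A) where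
  carrier := {x | Summable fun k => x k * star (x k)}
  add_mem' hx hy := summable_add_mul_star hx hy
  zero_mem' := by simp [summable_zero]
  smul_mem' a _ hx := summable_smul_mul_star a hx

/-- The standard Hilbert module over `A`. It is a type of its own, so that its topology is the one
of the Hilbert module norm and not that of pointwise convergence. -/
def StandardModule (A : Type*) [CStarAlgebra A] : Type _ := standardSubmodule A

namespace StandardModule

instance : AddCommGroup (StandardModule A) := inferInstanceAs (AddCommGroup (standardSubmodule A))
instance : Module A (StandardModule A) := inferInstanceAs (Module A (standardSubmodule A))
instance : Module ℂ (StandardModule A) := inferInstanceAs (Module ℂ (standardSubmodule A))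
instance : IsScalarTower ℂ A (StandardModule A) :=
  inferInstanceAs (IsScalarTower ℂ A (standardSubmodule A))

instance : CoeFun (StandardModule A) (fun _ => ℕ → A) := ⟨fun x => x.1⟩

@[ext] theorem ext {x y : StandardModule A} (h : ∀ k, x k = y k) : x = y := Subtype.ext (funext h)

@[simp] theorem add_apply (x y : StandardModule A) (k : ℕ) : (x + y) k = x k + y k := rfl
@[simp] theorem zero_apply (k : ℕ) : (0 : StandardModule A) k = 0 := rfl
@[simp] theorem smul_apply (a : A) (x : StandardModule A) (k : ℕ) : (a • x) k = a * x k := rfl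
@[simp] theorem complex_smul_apply (c : ℂ) (x : StandardModule A) (k : ℕ) :
    (c • x) k = c • x k := rfl

theorem summable_inner (x y : StandardModule A) : Summable fun k => y k * star (x k) :=
  summable_mul_star x.2 y.2

/-- The inner product `⟪x, y⟫ = ∑ y k (x k)⋆`. -/
instance : Inner A (StandardModule A) := ⟨fun x y => ∑' k, y k * star (x k)⟩

theorem inner_def (x y : StandardModule A) : ⟪x, y⟫_A = ∑' k, y k * star (x k) := rfl

/-- The norm `‖x‖ = ‖⟪x, x⟫‖ ^ (1 / 2)`. -/
instance : Norm (StandardModule A) := CStarModule.norm A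

variable [PartialOrder A] [StarOrderedRing A]

instance : CStarModule A (StandardModule A) where
  inner_add_right {x y z} := by
    simp only [inner_def, add_apply, add_mul]
    exact (summable_inner x y).tsum_add (summable_inner x z)
  inner_self_nonneg := tsum_nonneg fun k => mul_star_self_nonneg _
  inner_self {x} := by
    constructor
    · intro h
      ext k
      have h1 : x k * star (x k) ≤ ⟪x, x⟫_A :=
        (summable_inner x x).le_tsum k fun j _ => mul_star_self_nonneg _
      rw [h] at h1
      exact (CStarRing.mul_star_self_eq_zero_iff _).1 (le_antisymm h1 (mul_star_self_nonneg _))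
    · rintro rfl
      simp [inner_def]
  inner_op_smul_right {a x y} := by
    simp only [inner_def, smul_apply, mul_assoc]
    exact (summable_inner x y).tsum_mul_left a
  inner_smul_right_complex {c x y} := by
    simp only [inner_def, complex_smul_apply, smul_mul_assoc]
    exact (summable_inner x y).tsum_const_smul c
  star_inner x y := by
    simp only [inner_def]
    rw [tsum_star]
    simp
  norm_eq_sqrt_norm_inner_self _ := rfl

instance : NormedAddCommGroup (StandardModule A) :=
  NormedAddCommGroup.ofCore (CStarModule.normedSpaceCore A)

instance : NormedSpace ℂ (StandardModule A) := .ofCore (CStarModule.normedSpaceCore A)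

end StandardModule

end Standard

/-! ### Adjointable operators -/

section Operators

variable (A E : Type*) [CStarAlgebra A] [PartialOrder A] [StarOrderedRing A]
  [NormedAddCommGroup E] [NormedSpace ℂ E] [Module A E] [CStarModule A E]

/-- A bounded adjointable operator on the Hilbert module `E`: a bounded `A`-linear map together with
its (unique, see `AdjointableOp.ext`) bounded `A`-linear adjoint. -/
structure AdjointableOp where
  toCLM : E →L[A] E
  adjCLM : E →L[A] E
  inner_left : ∀ x y : E, ⟪toCLM x, y⟫_A = ⟪x, adjCLM y⟫_A

namespace AdjointableOp

variable {A E}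

instance : CoeFun (AdjointableOp A E) (fun _ => E → E) := ⟨fun F => F.toCLM⟩

theorem ext {F G : AdjointableOp A E} (h : ∀ x, F x = G x) : F = G := by
  obtain ⟨F, Fs, hF⟩ := F
  obtain ⟨G, Gs, hG⟩ := G
  obtain rfl : F = G := ContinuousLinearMap.ext h
  obtain rfl : Fs = Gs := by
    refine ContinuousLinearMap.ext fun y => ?_
    rw [← sub_eq_zero, ← CStarModule.inner_self (A := A), CStarModule.inner_sub_right, ← hF, ← hG,
      sub_self]
  rfl

/-- The adjoint `F⋆` of an adjointable operator. -/
def adjoint (F : AdjointableOp A E) : AdjointableOp A E where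
  toCLM := F.adjCLM
  adjCLM := F.toCLM
  inner_left x y := by
    rw [← CStarModule.star_inner, ← F.inner_left, CStarModule.star_inner]

end AdjointableOp

/-! ### Classes of semi-Fredholm operators -/

variable {A E}

/-- `E = M₁ ⊕̃ N₁ → M₂ ⊕̃ N₂ = E` are decompositions of `E` into closed submodules (not necessarily
orthogonal) with respect to which the matrix of `F` is diagonal, with an isomorphism `M₁ → M₂` of
Banach modules (bounded, `A`-linear, with bounded inverse) as its first entry. -/
structure IsDiagonalDecomposition (F : AdjointableOp A E) (M₁ N₁ M₂ N₂ : Submodule A E) : Prop where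
  isClosed_M₁ : IsClosed (M₁ : Set E)
  isClosed_N₁ : IsClosed (N₁ : Set E)
  isClosed_M₂ : IsClosed (M₂ : Set E)
  isClosed_N₂ : IsClosed (N₂ : Set E)
  isCompl_domain : IsCompl M₁ N₁
  isCompl_range : IsCompl M₂ N₂
  exists_equiv : ∃ F₁ : M₁ ≃L[A] M₂, ∀ x : M₁, (F₁ x : E) = F x
  map_N : ∀ x ∈ N₁, F x ∈ N₂

/-- `N ⪯ N'`: the submodule `N` is isomorphic to a closed submodule of `N'`. -/
def IsSubequivalent (N N' : Submodule A E) : Prop :=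
  ∃ P : Submodule A E, P ≤ N' ∧ IsClosed (P : Set E) ∧ Nonempty (N ≃L[A] P)

variable (A E)

/-- `MΦ₊`: upper semi-`A`-Fredholm operators. -/
def MPhiPlus : Set (AdjointableOp A E) :=
  {F | ∃ M₁ N₁ M₂ N₂ : Submodule A E, IsDiagonalDecomposition F M₁ N₁ M₂ N₂ ∧ N₁.FG}

/-- `MΦ₋`: lower semi-`A`-Fredholm operators. -/
def MPhiMinus : Set (AdjointableOp A E) :=
  {F | ∃ M₁ N₁ M₂ N₂ : Submodule A E, IsDiagonalDecomposition F M₁ N₁ M₂ N₂ ∧ N₂.FG}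

/-- `MΦ`: `A`-Fredholm operators. -/
def MPhi : Set (AdjointableOp A E) :=
  {F | ∃ M₁ N₁ M₂ N₂ : Submodule A E, IsDiagonalDecomposition F M₁ N₁ M₂ N₂ ∧ N₁.FG ∧ N₂.FG}

/-- The class `MΦ₊⁻′`. -/
def MPhiPlusMinusPrime : Set (AdjointableOp A E) :=
  {F | F ∈ MPhiPlus A E ∧ ∃ M₁ N₁ M₂ N₂ : Submodule A E,
    IsDiagonalDecomposition F M₁ N₁ M₂ N₂ ∧ N₁.FG ∧ IsSubequivalent N₁ N₂}

/-- The class `MΦ₋⁺′`. -/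
def MPhiMinusPlusPrime : Set (AdjointableOp A E) :=
  {F | F ∈ MPhiMinus A E ∧ ∃ M₁ N₁ M₂ N₂ : Submodule A E,
    IsDiagonalDecomposition F M₁ N₁ M₂ N₂ ∧ N₂.FG ∧ IsSubequivalent N₂ N₁}

/-- The tilde class of `MΦ₊⁻`. -/
def MPhiPlusMinusTilde : Set (AdjointableOp A E) :=
  {F | F ∈ MPhi A E ∧ ∃ M₁ N₁ M₂ N₂ : Submodule A E,
    IsDiagonalDecomposition F M₁ N₁ M₂ N₂ ∧ N₁.FG ∧ N₂.FG ∧ IsSubequivalent N₁ N₂}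

/-- The tilde class of `MΦ₋⁺`. -/
def MPhiMinusPlusTilde : Set (AdjointableOp A E) :=
  {F | F ∈ MPhi A E ∧ ∃ M₁ N₁ M₂ N₂ : Submodule A E,
    IsDiagonalDecomposition F M₁ N₁ M₂ N₂ ∧ N₁.FG ∧ N₂.FG ∧ IsSubequivalent N₂ N₁}

/-- The class `MΦ₊⁻`. -/
def MPhiPlusMinus : Set (AdjointableOp A E) :=
  MPhiPlusMinusTilde A E ∪ (MPhiPlus A E \ MPhi A E)

/-- The class `MΦ₋⁺`. -/
def MPhiMinusPlus : Set (AdjointableOp A E) :=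
  MPhiMinusPlusTilde A E ∪ (MPhiMinus A E \ MPhi A E)

end Operators

end

/-! A diagonal decomposition of `F` amounts to a bounded outer inverse `G`, that is `G F G = G`,
with `N₁ = ker (G F)` and `N₂ = ker G`: take `F₁⁻¹` after the projection onto `M₂` along `N₂`. If
`G` is adjointable, then `G⋆` is an outer inverse of `F⋆`. The complements it produces are `ker (G⋆
F⋆) = ker (F G)⋆` and `ker G⋆ = ker (F⋆ G⋆) = ker (G F)⋆`. The kernels of an adjointable idempotent
and of its adjoint are isomorphic, so these are copies of `ker (F G) = N₂` and `ker (G F) = N₁`. The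
complements thus change places, up to isomorphism, and every class goes to its mirror image.

The difficulty is that the projections of a decomposition into closed submodules need not be
adjointable, hence neither need `G`. Finite generation of one complement repairs this. A closed
finitely generated `N` is the range of an adjointable operator, and an adjointable operator `T` with
closed range has an adjointable inner inverse, because `T T⋆` is invertible on the range. Hence `N`
is the range of an adjointable idempotent `p`. Cutting `F` down by `1 - p`, on the right if `N = N₁`
and on the left if `N = N₂`, again gives an adjointable operator with closed range, and its inner
inverse yields an adjointable outer inverse of `F` with isomorphic kernels. -/

/-! ### Invertibility by the method of continuity -/

/-- If `S + t` is bounded below by `c > 0`, uniformly in `t ≥ 0`, then `S` is invertible. -/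
theorem ContinuousLinearMap.isUnit_of_forall_le_norm_add_smul {X : Type*} [NormedAddCommGroup X]
    [NormedSpace ℂ X] [CompleteSpace X] (S : X →L[ℂ] X) {c : ℝ} (hc : 0 < c)
    (h : ∀ t : ℝ, 0 ≤ t → ∀ x, c * ‖x‖ ≤ ‖S x + (t : ℂ) • x‖) : IsUnit S := by
  rcases subsingleton_or_nontrivial X with hX | hX
  · exact isUnit_of_subsingleton S
  -- `S + t` is invertible for `t > ‖S‖` by the spectral radius bound. Where it is invertible its
  -- inverse has norm at most `c⁻¹`, so `t` can be lowered by `c / 2` at a time until it reaches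
  -- `0`.
  have key : ∀ n : ℕ, ∀ t : ℝ, 0 ≤ t → ‖S‖ + 1 - n * (c / 2) ≤ t →
      IsUnit (S + (t : ℂ) • (1 : X →L[ℂ] X)) := by
    intro n
    induction n with
    | zero =>
      intro t ht htS
      have hmem : (-t : ℂ) ∉ spectrum ℂ S := fun hm => by
        have h1 := spectrum.norm_le_norm_of_mem hm
        rw [norm_neg, Complex.norm_real, Real.norm_of_nonneg ht] at h1
        simp only [Nat.cast_zero, zero_mul, sub_zero] at htS
        linarith
      have h2 := (spectrum.notMem_iff.1 hmem).neg
      convert h2 using 1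
      rw [Algebra.algebraMap_eq_smul_one, neg_smul]
      abel
    | succ n ih =>
      intro t ht htS
      obtain ⟨u, hu⟩ := ih (t + c / 2) (by linarith) (by push_cast at htS; linarith)
      have hinv : ‖(↑u⁻¹ : X →L[ℂ] X)‖ ≤ c⁻¹ := by
        refine ContinuousLinearMap.opNorm_le_bound _ (by positivity) fun x => ?_
        have h1 := h (t + c / 2) (by linarith) ((↑u⁻¹ : X →L[ℂ] X) x)
        have h2 : S ((↑u⁻¹ : X →L[ℂ] X) x) + ((t + c / 2 : ℝ) : ℂ) • (↑u⁻¹ : X →L[ℂ] X) x = x := by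
          have h3 := congrArg (fun T : X →L[ℂ] X => T x) u.mul_inv
          simpa [hu] using h3
        rw [h2] at h1
        rw [inv_mul_eq_div, le_div_iff₀ hc]
        linarith
      have hpos : 0 < ‖(↑u⁻¹ : X →L[ℂ] X)‖ := norm_pos_iff.2 u⁻¹.ne_zero
      have hlt : ‖(S + (t : ℂ) • (1 : X →L[ℂ] X)) - u‖ < ‖(↑u⁻¹ : X →L[ℂ] X)‖⁻¹ := by
        have h1 : (S + (t : ℂ) • (1 : X →L[ℂ] X)) - u = (-(c / 2 : ℝ) : ℂ) • 1 := by
          rw [hu]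
          push_cast
          module
        rw [h1, norm_smul, norm_one, mul_one, norm_neg, Complex.norm_real,
          Real.norm_of_nonneg (by linarith)]
        have h2 : c ≤ ‖(↑u⁻¹ : X →L[ℂ] X)‖⁻¹ := by
          rw [le_inv_comm₀ hc hpos]
          exact hinv
        linarith
      exact (u.ofNearby _ hlt).isUnit
  obtain ⟨n, hn⟩ := exists_nat_ge ((‖S‖ + 1) / (c / 2))
  rw [div_le_iff₀ (by linarith)] at hn
  simpa using key n 0 le_rfl (by linarith)

/-! ### Completeness of the standard module -/

namespace StandardModule

variable {A : Type*} [CStarAlgebra A] [PartialOrder A] [StarOrderedRing A]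

theorem norm_sum_mul_star_le (x : StandardModule A) (s : Finset ℕ) :
    ‖∑ k ∈ s, x k * star (x k)‖ ≤ ‖x‖ ^ 2 := by
  rw [CStarModule.norm_sq_eq A]
  exact CStarAlgebra.norm_le_norm_of_nonneg_of_le (Finset.sum_nonneg fun k _ =>
    mul_star_self_nonneg _) ((summable_inner x x).sum_le_tsum s fun k _ => mul_star_self_nonneg _)

theorem norm_apply_le (x : StandardModule A) (k : ℕ) : ‖x k‖ ≤ ‖x‖ := by
  have h := norm_sum_mul_star_le x {k}
  rw [Finset.sum_singleton, CStarRing.norm_self_mul_star, ← sq] at h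
  exact (pow_le_pow_iff_left₀ (norm_nonneg _) (norm_nonneg _) two_ne_zero).1 h

/-- The parallelogram identity, after dropping the positive term `(x - y)(x - y)⋆`. -/
theorem norm_sum_add_mul_star_le (x y : ℕ → A) (s : Finset ℕ) :
    ‖∑ k ∈ s, (x k + y k) * star (x k + y k)‖ ≤
      2 * ‖∑ k ∈ s, x k * star (x k)‖ + 2 * ‖∑ k ∈ s, y k * star (y k)‖ := by
  have h : ∑ k ∈ s, (x k + y k) * star (x k + y k) ≤
      (2 : ℝ) • (∑ k ∈ s, x k * star (x k)) + (2 : ℝ) • ∑ k ∈ s, y k * star (y k) := by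
    rw [Finset.smul_sum, Finset.smul_sum, ← Finset.sum_add_distrib]
    refine Finset.sum_le_sum fun k _ => ?_
    have h0 : 0 ≤ (x k - y k) * star (x k - y k) := mul_star_self_nonneg _
    rw [← sub_nonneg]
    convert h0 using 1
    simp only [star_add, star_sub, two_smul]
    noncomm_ring
  refine (CStarAlgebra.norm_le_norm_of_nonneg_of_le (Finset.sum_nonneg fun k _ =>
    mul_star_self_nonneg _) h).trans ((norm_add_le _ _).trans_eq ?_)
  simp [norm_smul]

/-- Completeness is what makes the open mapping and closed graph theorems available below. -/
instance : CompleteSpace (StandardModule A) := by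
  refine Metric.complete_of_cauchySeq_tendsto fun u hu => ?_
  have hcoord : ∀ k, ∃ a : A, Filter.Tendsto (fun n => u n k) Filter.atTop (nhds a) := by
    intro k
    refine cauchySeq_tendsto_of_complete (Metric.cauchySeq_iff.2 fun ε hε => ?_)
    obtain ⟨N, hN⟩ := Metric.cauchySeq_iff.1 hu ε hε
    refine ⟨N, fun m hm n hn => lt_of_le_of_lt ?_ (hN m hm n hn)⟩
    rw [dist_eq_norm, dist_eq_norm]
    exact norm_apply_le (u m - u n) k
  choose v hv using hcoord
  -- Coordinatewise limits commute with finite sums only, so the Cauchy estimate is passed to the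
  -- limit on each finite set, with `N` independent of that set.
  have hclose : ∀ ε > 0, ∃ N, ∀ n ≥ N, ∀ s : Finset ℕ,
      ‖∑ k ∈ s, (v k - u n k) * star (v k - u n k)‖ ≤ ε ^ 2 := by
    intro ε hε
    obtain ⟨N, hN⟩ := Metric.cauchySeq_iff.1 hu ε hε
    refine ⟨N, fun n hn s => ?_⟩
    have hlim : Filter.Tendsto (fun m => ‖∑ k ∈ s, (u m k - u n k) * star (u m k - u n k)‖)
        Filter.atTop (nhds ‖∑ k ∈ s, (v k - u n k) * star (v k - u n k)‖) := by
      refine (tendsto_finsetSum _ fun k _ => ?_).norm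
      exact ((hv k).sub_const _).mul ((hv k).sub_const _).star
    refine le_of_tendsto hlim (Filter.eventually_atTop.2 ⟨N, fun m hm => ?_⟩)
    refine (norm_sum_mul_star_le (u m - u n) s).trans ?_
    have h1 := hN m hm n hn
    rw [dist_eq_norm] at h1
    exact pow_le_pow_left₀ (norm_nonneg _) h1.le 2
  have hsum : Summable fun k => v k * star (v k) := by
    rw [summable_iff_vanishing_norm]
    intro ε hε
    obtain ⟨N, hN⟩ := hclose (√(ε / 8)) (by positivity)
    obtain ⟨s, hs⟩ := summable_iff_vanishing_norm.1 (summable_inner (u N) (u N)) (ε / 8)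
      (by positivity)
    refine ⟨s, fun t ht => ?_⟩
    have h1 := norm_sum_add_mul_star_le (fun k => v k - u N k) (u N) t
    simp only [sub_add_cancel] at h1
    have h2 := hN N le_rfl t
    rw [Real.sq_sqrt (by positivity)] at h2
    have h3 := hs t ht
    linarith
  let w : StandardModule A := ⟨v, hsum⟩
  refine ⟨w, Metric.tendsto_atTop.2 fun ε hε => ?_⟩
  obtain ⟨N, hN⟩ := hclose (ε / 2) (by positivity)
  refine ⟨N, fun n hn => ?_⟩
  have h1 : ‖w - u n‖ ^ 2 ≤ (ε / 2) ^ 2 := by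
    rw [CStarModule.norm_sq_eq A]
    exact le_of_tendsto (summable_inner (w - u n) (w - u n)).hasSum.norm
      (Filter.Eventually.of_forall fun s => hN n hn s)
  have h2 := (pow_le_pow_iff_left₀ (norm_nonneg _) (by positivity) two_ne_zero).1 h1
  rw [dist_comm, dist_eq_norm]
  linarith

end StandardModule

/-! ### Adjoint pairs of operators on a Hilbert module -/

namespace CStarModule

section Adjoint

variable {A E : Type*} [CStarAlgebra A] [PartialOrder A] [NormedAddCommGroup E]
  [NormedSpace ℂ E] [Module A E] [CStarModule A E]

/-- The operators `T` and `T'` are adjoint to each other. -/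
def AreAdjoint (T T' : E →L[A] E) : Prop := ∀ x y, ⟪T x, y⟫_A = ⟪x, T' y⟫_A

namespace AreAdjoint

variable {T T' S S' : E →L[A] E}

theorem symm (h : AreAdjoint T T') : AreAdjoint T' T := fun x y => by
  rw [← star_inner, ← h, star_inner]

theorem sub (hT : AreAdjoint T T') (hS : AreAdjoint S S') : AreAdjoint (T - S) (T' - S') :=
  fun x y => by simp [hT x y, hS x y]

theorem mul (hT : AreAdjoint T T') (hS : AreAdjoint S S') : AreAdjoint (T * S) (S' * T') :=
  fun x y => by simp [hT _ y, hS x _]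

theorem one : AreAdjoint (1 : E →L[A] E) 1 := fun x y => by simp

theorem sum {ι : Type*} {s : Finset ι} {T T' : ι → E →L[A] E}
    (h : ∀ i ∈ s, AreAdjoint (T i) (T' i)) : AreAdjoint (∑ i ∈ s, T i) (∑ i ∈ s, T' i) :=
  fun x y => by
    simp only [sum_apply, inner_sum_left, inner_sum_right]
    exact Finset.sum_congr rfl fun i hi => h i hi x y

/-- Uniqueness of the adjoint carries algebraic identities between operators over to their adjoints.
-/
theorem eq (h : AreAdjoint T T') (h' : AreAdjoint T S) : T' = S :=
  ContinuousLinearMap.ext fun y => by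
    rw [← sub_eq_zero, ← inner_self (A := A), inner_sub_right, ← h, ← h', sub_self]

end AreAdjoint

end Adjoint

/-! ### Adjointable operators with closed range -/

section ClosedRange

variable {A E : Type*} [CStarAlgebra A] [PartialOrder A] [StarOrderedRing A]
  [NormedAddCommGroup E] [NormedSpace ℂ E] [Module A E] [IsScalarTower ℂ A E] [CStarModule A E]
  [CompleteSpace E] {T T' : E →L[A] E}

/-- The adjoint of an operator with closed range is bounded below on the range. -/
theorem AreAdjoint.exists_norm_le_norm_adjoint (h : AreAdjoint T T')
    (hT : IsClosed (T.range : Set E)) : ∃ C > 0, ∀ y ∈ T.range, ‖y‖ ≤ C * ‖T' y‖ := by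
  have : CompleteSpace T.range := hT.completeSpace_coe
  let T₀ : E →L[ℂ] T.range :=
    (T.codRestrict T.range fun x => ⟨x, rfl⟩).restrictScalars ℂ
  have hsurj : Function.Surjective T₀ := by
    rintro ⟨_, x, rfl⟩
    exact ⟨x, rfl⟩
  -- By the open mapping theorem `y = T x` with `‖x‖ ≤ C ‖y‖`; then `‖y‖² = ‖⟪x, T' y⟫‖ ≤ C ‖y‖ ‖T'
  -- y‖`.
  obtain ⟨C, hC, hpre⟩ := T₀.exists_preimage_norm_le hsurj
  refine ⟨C, hC, fun y hy => ?_⟩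
  obtain ⟨x, hx, hxy⟩ := hpre ⟨y, hy⟩
  have hxy' : T x = y := congrArg Subtype.val hx
  change ‖x‖ ≤ C * ‖y‖ at hxy
  rcases eq_or_ne y 0 with rfl | hy0
  · simp
  have hpos : 0 < ‖y‖ := norm_pos_iff.2 hy0
  have h1 : ‖y‖ ^ 2 ≤ ‖x‖ * ‖T' y‖ := by
    rw [norm_sq_eq A]
    conv_lhs => rw [← hxy', h, hxy']
    exact norm_inner_le E
  have h2 : ‖x‖ * ‖T' y‖ ≤ C * ‖y‖ * ‖T' y‖ := by gcongr
  nlinarith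

/-- If `T` has closed range, then `T T⋆` is invertible on the range of `T`. -/
theorem AreAdjoint.exists_inverse_on_range (h : AreAdjoint T T')
    (hT : IsClosed (T.range : Set E)) :
    ∃ L : T.range →L[A] T.range, (∀ y : T.range, T (T' (L y)) = y) ∧
      ∀ y z : T.range, (z : E) = T (T' y) → L z = y := by
  have : CompleteSpace T.range := hT.completeSpace_coe
  obtain ⟨C, hC, hlow⟩ := h.exists_norm_le_norm_adjoint hT
  let S : T.range →L[A] T.range :=
    ((T * T').comp T.range.subtypeL).codRestrict T.range fun x => ⟨T' x, rfl⟩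
  have hS : ∀ y, (S y : E) = T (T' y) := fun y => rfl
  have hunit : IsUnit (S.restrictScalars ℂ) := by
    refine ContinuousLinearMap.isUnit_of_forall_le_norm_add_smul _
      (c := (C ^ 2)⁻¹) (by positivity) fun t ht y => ?_
    change _ ≤ ‖T (T' y) + (t : ℂ) • (y : E)‖
    change _ * ‖(y : E)‖ ≤ _
    rcases eq_or_ne (y : E) 0 with hy | hy
    · simp [hy]
    have hpos : 0 < ‖(y : E)‖ := norm_pos_iff.2 hy
    have h1 := hlow y y.2
    -- `⟪T T' y + t y, y⟫` exceeds `⟪T' y, T' y⟫` by the positive element `t ⟪y, y⟫`; Cauchy–Schwarz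
    -- does the rest.
    have h2 : ‖T' y‖ ^ 2 ≤ ‖T (T' y) + (t : ℂ) • (y : E)‖ * ‖(y : E)‖ := by
      rw [norm_sq_eq A]
      refine le_trans (CStarAlgebra.norm_le_norm_of_nonneg_of_le inner_self_nonneg ?_)
        (norm_inner_le E (A := A))
      rw [inner_add_left, h, inner_smul_left_complex]
      refine le_add_of_nonneg_right ?_
      have h3 : star (t : ℂ) • ⟪(y : E), y⟫_A = t • ⟪(y : E), y⟫_A := by
        simp
      rw [h3]
      exact smul_nonneg ht inner_self_nonneg
    rw [inv_mul_le_iff₀ (by positivity)]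
    have h3 : ‖(y : E)‖ ^ 2 ≤ (C * ‖T' y‖) ^ 2 := pow_le_pow_left₀ hpos.le h1 2
    rw [mul_pow] at h3
    have h4 : C ^ 2 * ‖T' y‖ ^ 2 ≤ C ^ 2 * (‖T (T' y) + (t : ℂ) • (y : E)‖ * ‖(y : E)‖) := by
      gcongr
    nlinarith
  obtain ⟨u, hu⟩ := hunit
  have huS : ∀ y, S ((↑u⁻¹ : T.range →L[ℂ] T.range) y) = y := fun y => by
    have h1 := congrArg (fun R : T.range →L[ℂ] T.range => R y) u.mul_inv
    rw [hu] at h1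
    exact h1
  have hSu : ∀ y, (↑u⁻¹ : T.range →L[ℂ] T.range) (S y) = y := fun y => by
    have h1 := congrArg (fun R : T.range →L[ℂ] T.range => R y) u.inv_mul
    rw [hu] at h1
    exact h1
  -- The inverse was found among `ℂ`-linear operators; it is `A`-linear because `S` is.
  refine ⟨⟨{ toFun := (↑u⁻¹ : T.range →L[ℂ] T.range), map_add' := map_add _, map_smul' := ?_ },
    (↑u⁻¹ : T.range →L[ℂ] T.range).continuous⟩, ?_, ?_⟩
  · intro a y
    conv_lhs => rw [← huS y, ← map_smul, hSu]
    rfl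
  · intro y
    exact congrArg Subtype.val (huS y)
  · intro y z hz
    obtain rfl : z = S y := Subtype.ext hz
    exact hSu y

/-- An adjointable operator `T` with closed range has an adjointable inner inverse `S` for which
`T S` is self-adjoint. -/
theorem AreAdjoint.exists_inner_inverse (h : AreAdjoint T T') (hT : IsClosed (T.range : Set E)) :
    ∃ S S' : E →L[A] E, AreAdjoint S S' ∧ T * S * T = T ∧ AreAdjoint (T * S) (T * S) := by
  obtain ⟨L, hTL, hLT⟩ := h.exists_inverse_on_range hT
  let T₀ : E →L[A] T.range := T.codRestrict T.range fun x => ⟨x, rfl⟩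
  have hT₀ : ∀ x, (T₀ x : E) = T x := fun x => rfl
  let i : T.range →L[A] E := T.range.subtypeL
  have hL : ∀ y z : T.range, ⟪(L y : E), (z : E)⟫_A = ⟪(y : E), (L z : E)⟫_A := fun y z => by
    rw [← hTL z, ← h.symm, ← h, hTL]
  have hLTT : ∀ x, L (T₀ (T' (T x))) = T₀ x := fun x => hLT _ _ rfl
  have hproj : ∀ x, T' (L (T₀ (T' x))) = T' x := fun x => by
    have h1 : T (T' (L (T₀ (T' x))) - T' x) = 0 := by rw [map_sub, hTL, hT₀, sub_self]
    have h2 : T' (L (T₀ (T' x))) - T' x = T' (L (T₀ (T' x)) - x) := (map_sub T' _ _).symm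
    rw [← sub_eq_zero, ← inner_self (A := A)]
    nth_rw 1 [h2]
    rw [h.symm, h1, inner_zero_right]
  -- With `L = (T T⋆)⁻¹` on the range, `L T T⋆` is the orthogonal projection onto the range, and `S`
  -- is `T⋆ L` applied after it. Its adjoint is `L T`.
  refine ⟨T' * (i ∘L L ∘L L ∘L T₀ * T'), i ∘L L ∘L T₀, fun x y => ?_, ?_, fun x y => ?_⟩
  · change ⟪T' (L (L (T₀ (T' x)))), y⟫_A = ⟪x, (L (T₀ y) : E)⟫_A
    rw [h.symm, ← hT₀, hL, hL, hT₀, h, h.symm, hTL]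
  · ext x
    change T (T' (L (L (T₀ (T' (T x)))))) = T x
    rw [hTL, hLTT, hT₀]
  · change ⟪T (T' (L (L (T₀ (T' x))))), y⟫_A = ⟪x, T (T' (L (L (T₀ (T' y)))))⟫_A
    have hmem : ∀ (z : T.range) w, ⟪(z : E), w⟫_A = ⟪(z : E), (L (T₀ (T' w)) : E)⟫_A := by
      rintro ⟨_, z, rfl⟩ w
      exact (h z w).trans ((congrArg _ (hproj w).symm).trans (h z _).symm)
    rw [hTL, hTL, hmem _ y, ← star_inner (L (T₀ (T' y)) : E) x, hmem _ x, star_inner]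

end ClosedRange

end CStarModule

/-! ### Finitely generated submodules of the standard module -/

namespace CStarModule

variable {A E : Type*} [CStarAlgebra A] [PartialOrder A] [StarOrderedRing A]
  [NormedAddCommGroup E] [NormedSpace ℂ E] [Module A E] [CStarModule A E]

omit [StarOrderedRing A] in
theorem norm_smul_le (a : A) (x : E) : ‖a • x‖ ≤ ‖a‖ * ‖x‖ := by
  refine (pow_le_pow_iff_left₀ (norm_nonneg _) (by positivity) two_ne_zero).1 ?_
  rw [mul_pow, norm_sq_eq A (x := a • x), norm_sq_eq A (x := x), inner_op_smul_right,
    inner_op_smul_left]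
  refine (norm_mul_le _ _).trans ?_
  have h := norm_mul_le ⟪x, x⟫_A (star a)
  rw [norm_star] at h
  nlinarith [norm_nonneg a]

/-- The operator `y ↦ ⟪g, y⟫ • e`. -/
noncomputable def innerSMul (g e : E) : E →L[A] E where
  toFun y := ⟪g, y⟫_A • e
  map_add' x y := by rw [CStarModule.inner_add_right, add_smul]
  map_smul' a x := by rw [inner_op_smul_right, mul_smul, RingHom.id_apply]
  cont := by
    refine AddMonoidHomClass.continuous_of_bound
      (AddMonoidHom.mk' (fun y : E => ⟪g, y⟫_A • e)
        fun x y => by rw [CStarModule.inner_add_right, add_smul]) (‖e‖ * ‖g‖) fun x => ?_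
    change ‖⟪g, x⟫_A • e‖ ≤ _
    refine (CStarModule.norm_smul_le _ _).trans ?_
    rw [mul_comm, mul_assoc]
    exact mul_le_mul_of_nonneg_left (norm_inner_le _) (norm_nonneg _)

end CStarModule

namespace StandardModule

open CStarModule

variable {A : Type*} [CStarAlgebra A]

open Classical in
/-- The standard basis vectors. -/
noncomputable def basisVector (A : Type*) [CStarAlgebra A] (k : ℕ) : StandardModule A :=
  ⟨Pi.single k 1, summable_of_ne_finset_zero (s := {k}) fun j hj => by
    rw [Finset.mem_singleton] at hj
    simp [hj]⟩

theorem basisVector_apply (k j : ℕ) : basisVector A k j = if j = k then 1 else 0 := by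
  change (Pi.single k 1 : ℕ → A) j = _
  rw [Pi.single_apply]

theorem inner_basisVector (x : StandardModule A) (k : ℕ) : ⟪x, basisVector A k⟫_A = star (x k) := by
  rw [inner_def, tsum_eq_single k fun j hj => by simp [basisVector_apply, hj]]
  simp [basisVector_apply]

variable [PartialOrder A] [StarOrderedRing A]

/-- The operator `x ↦ x k • g`. -/
noncomputable def coordSMul (k : ℕ) (g : StandardModule A) :
    StandardModule A →L[A] StandardModule A where
  toFun x := x k • g
  map_add' x y := by rw [add_apply, add_smul]
  map_smul' a x := by rw [smul_apply, mul_smul, RingHom.id_apply]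
  cont := by
    refine AddMonoidHomClass.continuous_of_bound
      (AddMonoidHom.mk' (fun x : StandardModule A => x k • g)
        fun x y => by rw [add_apply, add_smul]) ‖g‖ fun x => ?_
    change ‖x k • g‖ ≤ _
    refine (CStarModule.norm_smul_le _ _).trans ?_
    rw [mul_comm]
    exact mul_le_mul_of_nonneg_left (norm_apply_le x k) (norm_nonneg _)

theorem areAdjoint_coordSMul (k : ℕ) (g : StandardModule A) :
    AreAdjoint (coordSMul k g) (innerSMul g (basisVector A k)) := fun x y => by
  have h1 : coordSMul k g x = x k • g := rfl
  have h2 : innerSMul (A := A) g (basisVector A k) y = ⟪g, y⟫_A • basisVector A k := rfl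
  have h3 : ⟪x, basisVector A k⟫_A = star (x k) := inner_basisVector x k
  rw [h1, h2, inner_op_smul_left, inner_op_smul_right, h3]

/-- A finitely generated submodule is the range of an adjointable operator. -/
theorem exists_areAdjoint_range_eq {N : Submodule A (StandardModule A)} (hN : N.FG) :
    ∃ T T' : StandardModule A →L[A] StandardModule A, AreAdjoint T T' ∧ T.range = N := by
  obtain ⟨n, g, rfl⟩ := Submodule.fg_iff_exists_fin_generating_family.1 hN
  -- The operator sends the `i`-th basis vector to `g i` for `i < n` and ignores the remaining
  -- coordinates.
  refine ⟨∑ i : Fin n, coordSMul i (g i), ∑ i : Fin n, innerSMul (g i) (basisVector A i),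
    .sum fun i _ => areAdjoint_coordSMul i (g i), le_antisymm ?_ (Submodule.span_le.2 ?_)⟩
  · rintro _ ⟨x, rfl⟩
    change (∑ i : Fin n, coordSMul i (g i)) x ∈ _
    rw [sum_apply]
    exact Submodule.sum_mem _ fun i _ => Submodule.smul_mem _ _ (Submodule.subset_span ⟨i, rfl⟩)
  · rintro _ ⟨j, rfl⟩
    refine ⟨basisVector A j, ?_⟩
    change (∑ i : Fin n, coordSMul i (g i)) (basisVector A j) = _
    rw [sum_apply, Finset.sum_eq_single j]
    · change basisVector A j j • g j = g j
      rw [basisVector_apply, if_pos rfl, one_smul]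
    · intro i _ hij
      change basisVector A j i • g i = 0
      rw [basisVector_apply, if_neg fun h => hij (Fin.ext h), zero_smul]
    · simp

/-- A closed finitely generated submodule is the range of an adjointable idempotent. -/
theorem exists_adjointable_idempotent {N : Submodule A (StandardModule A)} (hN : N.FG)
    (hc : IsClosed (N : Set (StandardModule A))) :
    ∃ p p' : StandardModule A →L[A] StandardModule A,
      AreAdjoint p p' ∧ p * p = p ∧ p.range = N := by
  obtain ⟨T, T', h, rfl⟩ := exists_areAdjoint_range_eq hN
  obtain ⟨S, S', hS, hTST, -⟩ := h.exists_inner_inverse hc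
  refine ⟨T * S, S' * T', h.mul hS, by rw [← mul_assoc, hTST], le_antisymm ?_ ?_⟩
  · rintro _ ⟨x, rfl⟩
    exact ⟨S x, rfl⟩
  · rintro _ ⟨x, rfl⟩
    exact ⟨T x, congrArg (fun R : StandardModule A →L[A] StandardModule A => R x) hTST⟩

end StandardModule

/-! ### Idempotents and complements -/

section Idempotent

variable {R E : Type*} [Ring R] [NormedAddCommGroup E] [Module R E]

/-- A continuous linear equivalence between submodules, given by operators on the whole space. -/
noncomputable def ContinuousLinearEquiv.ofMapsTo {N N' : Submodule R E} (u v : E →L[R] E)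
    (hu : ∀ x ∈ N, u x ∈ N') (hv : ∀ x ∈ N', v x ∈ N) (hvu : ∀ x ∈ N, v (u x) = x)
    (huv : ∀ x ∈ N', u (v x) = x) : N ≃L[R] N' :=
  .equivOfInverse ((u ∘L N.subtypeL).codRestrict N' fun x => hu x x.2)
    ((v ∘L N'.subtypeL).codRestrict N fun x => hv x x.2)
    (fun x => Subtype.ext (hvu x x.2)) (fun x => Subtype.ext (huv x x.2))

namespace ContinuousLinearMap

theorem apply_eq_of_mul_eq {S T U : E →L[R] E} (h : S * T = U) (x : E) : S (T x) = U x := by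
  rw [← h]
  rfl

theorem range_eq_ker_one_sub {e : E →L[R] E} (he : e * e = e) : e.range = (1 - e).ker := by
  ext x
  constructor
  · rintro ⟨y, rfl⟩
    exact sub_eq_zero.2 (apply_eq_of_mul_eq he y).symm
  · intro hx
    exact ⟨x, (sub_eq_zero.1 hx).symm⟩

theorem isClosed_range_of_idempotent {e : E →L[R] E} (he : e * e = e) :
    IsClosed (e.range : Set E) := by
  rw [range_eq_ker_one_sub he]
  exact isClosed_ker _

/-- `F` is injective on the range of `G`. This replaces the kernel of an outer inverse by that of an
idempotent. -/
theorem ker_mul_eq_of_outer_inverse {F G : E →L[R] E} (h : G * F * G = G) :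
    (F * G).ker = G.ker := by
  refine le_antisymm (fun x hx => ?_) fun x hx => ?_
  · have hx' : F (G x) = 0 := hx
    have h1 : G (F (G x)) = G x := apply_eq_of_mul_eq h x
    rw [hx', map_zero] at h1
    exact h1.symm
  · have hx' : G x = 0 := hx
    change F (G x) = 0
    rw [hx', map_zero]

/-- Idempotents with the same range have isomorphic kernels. -/
theorem nonempty_ker_equiv_ker {e f : E →L[R] E} (hef : e * f = f) (hfe : f * e = e) :
    Nonempty (e.ker ≃L[R] f.ker) := by
  have hf : f * f = f := by nth_rw 2 [← hef]; rw [← mul_assoc, hfe, hef]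
  have he : e * e = e := by nth_rw 2 [← hfe]; rw [← mul_assoc, hef, hfe]
  -- Both kernels are complements of the same range, hence copies of the quotient by it.
  refine ⟨.ofMapsTo (1 - f) (1 - e) (fun x _ => ?_) (fun x _ => ?_) (fun x hx => ?_)
    fun x hx => ?_⟩
  · exact (map_sub f _ _).trans (sub_eq_zero.2 (apply_eq_of_mul_eq hf x).symm)
  · exact (map_sub e _ _).trans (sub_eq_zero.2 (apply_eq_of_mul_eq he x).symm)
  · have h : (1 - e) * (1 - f) = 1 - e := by rw [mul_one_sub, one_sub_mul, hef, sub_self, sub_zero]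
    have h' : e x = 0 := hx
    rw [apply_eq_of_mul_eq h x]
    simp [h']
  · have h : (1 - f) * (1 - e) = 1 - f := by rw [mul_one_sub, one_sub_mul, hfe, sub_self, sub_zero]
    have h' : f x = 0 := hx
    rw [apply_eq_of_mul_eq h x]
    simp [h']

/-- The projection onto a closed submodule along a closed complement is continuous. -/
theorem exists_projection_of_isCompl {A : Type*} [CStarAlgebra A] [Module A E] [NormedSpace ℂ E]
    [IsScalarTower ℂ A E] [CompleteSpace E] {M N : Submodule A E} (h : IsCompl M N)
    (hM : IsClosed (M : Set E)) (hN : IsClosed (N : Set E)) :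
    ∃ p : E →L[A] M, (∀ x : M, p x = x) ∧ ∀ x, p x = 0 ↔ x ∈ N := by
  have : CompleteSpace M := hM.completeSpace_coe
  have hcont : Continuous ((M.projectionOnto N h).restrictScalars ℂ) := by
    refine LinearMap.continuous_of_seq_closed_graph _ fun u x y hu hy => ?_
    have h1 : ∀ z, z - (M.projectionOnto N h z : E) ∈ N := fun z => by
      rw [← Submodule.projectionOnto_apply_eq_zero_iff h, map_sub,
        Submodule.projectionOnto_apply_left, sub_self]
    have h2 : x - (y : E) ∈ N := hN.mem_of_tendsto
      (hu.sub (continuous_subtype_val.continuousAt.tendsto.comp hy))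
      (Filter.Eventually.of_forall fun n => h1 (u n))
    have h3 : M.projectionOnto N h (x - y) = 0 := by
      exact (Submodule.projectionOnto_apply_eq_zero_iff h).2 h2
    rw [map_sub, Submodule.projectionOnto_apply_left, sub_eq_zero] at h3
    exact h3.symm
  refine ⟨⟨M.projectionOnto N h, hcont⟩, Submodule.projectionOnto_apply_left h,
    fun x => ?_⟩
  exact Submodule.projectionOnto_apply_eq_zero_iff h

end ContinuousLinearMap

end Idempotent

/-! ### Diagonal decompositions and outer inverses -/

section OuterInverse

open ContinuousLinearMap CStarModule

variable {A E : Type*} [CStarAlgebra A] [PartialOrder A] [StarOrderedRing A]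
  [NormedAddCommGroup E] [NormedSpace ℂ E] [Module A E] [CStarModule A E]

omit [StarOrderedRing A] in
/-- A diagonal decomposition gives a bounded outer inverse, which need not be adjointable. -/
theorem IsDiagonalDecomposition.exists_outer_inverse [IsScalarTower ℂ A E] [CompleteSpace E]
    {F : AdjointableOp A E} {M₁ N₁ M₂ N₂ : Submodule A E}
    (h : IsDiagonalDecomposition F M₁ N₁ M₂ N₂) :
    ∃ G : E →L[A] E, G * F.toCLM * G = G ∧ (G * F.toCLM).ker = N₁ ∧ G.ker = N₂ := by
  obtain ⟨F₁, hF₁⟩ := h.exists_equiv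
  obtain ⟨p, hp, hpN⟩ := exists_projection_of_isCompl h.isCompl_range h.isClosed_M₂ h.isClosed_N₂
  let G : E →L[A] E := M₁.subtypeL ∘L (F₁.symm : M₂ →L[A] M₁) ∘L p
  have hG : ∀ x, G x = F₁.symm (p x) := fun x => rfl
  have hGN : ∀ x, G x = 0 ↔ x ∈ N₂ := fun x => by
    rw [hG, ZeroMemClass.coe_eq_zero, EmbeddingLike.map_eq_zero_iff, hpN]
  have hGF : ∀ x : M₁, G (F x) = x := fun x => by
    rw [hG, ← hF₁, hp, F₁.symm_apply_apply]
  refine ⟨G, ?_, ?_, ?_⟩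
  · ext x
    exact hGF (F₁.symm (p x))
  · ext x
    constructor
    · intro hx
      obtain ⟨m, hm, n, hn, rfl⟩ : ∃ m ∈ M₁, ∃ n ∈ N₁, m + n = x :=
        Submodule.mem_sup.1 (h.isCompl_domain.sup_eq_top ▸ Submodule.mem_top)
      have h1 : G (F (m + n)) = 0 := hx
      rw [map_add, map_add, hGF ⟨m, hm⟩, (hGN _).2 (h.map_N n hn), add_zero] at h1
      have h2 : m = 0 := h1
      rwa [h2, zero_add]
    · intro hx
      exact (hGN _).2 (h.map_N x hx)
  · ext x
    exact hGN x

omit [StarOrderedRing A] in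
/-- An outer inverse gives a diagonal decomposition. -/
theorem isDiagonalDecomposition_of_outer_inverse (F : AdjointableOp A E) {G : E →L[A] E}
    (h : G * F.toCLM * G = G) :
    IsDiagonalDecomposition F (G * F.toCLM).range (G * F.toCLM).ker (F.toCLM * G).range G.ker := by
  have h₁ : G * F.toCLM * (G * F.toCLM) = G * F.toCLM := by rw [← mul_assoc, h]
  have h₂ : F.toCLM * G * (F.toCLM * G) = F.toCLM * G := by
    rw [mul_assoc, ← mul_assoc G, h]
  have hG : ∀ x, G (F (G x)) = G x := apply_eq_of_mul_eq h
  refine ⟨isClosed_range_of_idempotent h₁, isClosed_ker _, isClosed_range_of_idempotent h₂,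
    isClosed_ker _, ?_, ?_, ⟨.ofMapsTo F.toCLM G ?_ ?_ ?_ ?_, fun x => rfl⟩, fun x hx => hx⟩
  · rw [isCompl_iff, Submodule.disjoint_def, codisjoint_iff, eq_top_iff]
    constructor
    · rintro _ ⟨x, rfl⟩ hx
      have h1 : G (F (G (F x))) = 0 := hx
      rw [hG] at h1
      exact h1
    · intro x _
      refine Submodule.mem_sup.2 ⟨G (F x), ⟨x, rfl⟩, x - G (F x), ?_, add_sub_cancel _ _⟩
      change G (F (x - G (F x))) = 0
      rw [map_sub, map_sub, hG, sub_self]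
  · rw [isCompl_iff, Submodule.disjoint_def, codisjoint_iff, eq_top_iff]
    constructor
    · rintro _ ⟨x, rfl⟩ hx
      have h1 : G (F (G x)) = 0 := hx
      rw [hG] at h1
      change F (G x) = 0
      rw [h1, map_zero]
    · intro x _
      refine Submodule.mem_sup.2 ⟨F (G x), ⟨x, rfl⟩, x - F (G x), ?_, add_sub_cancel _ _⟩
      change G (x - F (G x)) = 0
      rw [map_sub, hG, sub_self]
  · rintro _ ⟨x, rfl⟩
    exact ⟨F x, rfl⟩
  · rintro _ ⟨x, rfl⟩
    exact ⟨G x, apply_eq_of_mul_eq (mul_assoc G F.toCLM G) x |>.symm ▸ rfl⟩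
  · rintro _ ⟨x, rfl⟩
    exact hG (F x)
  · rintro _ ⟨x, rfl⟩
    exact congrArg F (hG x)

variable [IsScalarTower ℂ A E] [CompleteSpace E]

/-- The kernels of an adjointable idempotent and of its adjoint are isomorphic. -/
theorem CStarModule.AreAdjoint.nonempty_ker_equiv_ker {e e' : E →L[A] E} (h : AreAdjoint e e')
    (he : e * e = e) : Nonempty (e.ker ≃L[A] e'.ker) := by
  have he' : e' * e' = e' := (h.mul h).eq (he.symm ▸ h)
  have hq : AreAdjoint (1 - e) (1 - e') := AreAdjoint.one.sub h
  have hqq : (1 - e) * (1 - e) = 1 - e := IsIdempotentElem.one_sub he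
  have hk : ∀ {a : E →L[A] E}, a * a = a → a.ker = (1 - a).range := fun {a} ha => by
    rw [range_eq_ker_one_sub (IsIdempotentElem.one_sub ha),
      sub_sub_cancel]
  obtain ⟨S, S', -, hS, hsa⟩ := hq.exists_inner_inverse (isClosed_range_of_idempotent hqq)
  set q := 1 - e
  set q' := 1 - e'
  -- `q S` is the orthogonal projection onto the range of `q`. Taking adjoints in `h1` and `h2`
  -- shows that `q'` and `q S` are mutually inverse between the ranges of `q` and `q'`.
  have h1 : q * (q * S) = q * S := by rw [← mul_assoc, hqq]
  have h2 : q * S * q = q := hS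
  have h3 : q * S * q' = q * S := (hq.mul hsa).eq (h1.symm ▸ hsa)
  have h4 : q' * (q * S) = q' := (hsa.mul hq).eq (h2.symm ▸ hq)
  rw [hk he, hk he']
  refine ⟨.ofMapsTo q' (q * S) (fun x _ => ⟨x, rfl⟩) (fun x _ => ⟨S x, rfl⟩) ?_ ?_⟩
  · rintro _ ⟨x, rfl⟩
    change (q * S) (q' (q x)) = q x
    rw [apply_eq_of_mul_eq h3, apply_eq_of_mul_eq h2]
  · rintro _ ⟨x, rfl⟩
    change q' ((q * S) (q' x)) = q' x
    rw [apply_eq_of_mul_eq h3, apply_eq_of_mul_eq h4]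

/-- An adjointable outer inverse of `F` gives a diagonal decomposition of `F⋆`. -/
theorem exists_isDiagonalDecomposition_adjoint (F : AdjointableOp A E) {G G' : E →L[A] E}
    (hG : AreAdjoint G G') (h : G * F.toCLM * G = G) :
    ∃ M₁ N₁ M₂ N₂ : Submodule A E, IsDiagonalDecomposition F.adjoint M₁ N₁ M₂ N₂ ∧
      Nonempty (G.ker ≃L[A] N₁) ∧ Nonempty ((G * F.toCLM).ker ≃L[A] N₂) := by
  have hF : AreAdjoint F.toCLM F.adjCLM := F.inner_left
  have h' : G' * F.adjoint.toCLM * G' = G' :=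
    (mul_assoc _ _ _).trans (((hG.mul hF).mul hG).eq (h.symm ▸ hG))
  refine ⟨_, _, _, _, isDiagonalDecomposition_of_outer_inverse F.adjoint h', ?_, ?_⟩
  · rw [← ker_mul_eq_of_outer_inverse h]
    exact (hF.mul hG).nonempty_ker_equiv_ker (by rw [mul_assoc, ← mul_assoc G, h])
  · rw [← ker_mul_eq_of_outer_inverse h']
    exact (hG.mul hF).nonempty_ker_equiv_ker (by rw [← mul_assoc, h])

end OuterInverse

/-! ### Subequivalence -/

section Subequivalent

variable {A E : Type*} [CStarAlgebra A] [NormedAddCommGroup E] [Module A E]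

theorem Submodule.FG.of_continuousLinearEquiv {N N' : Submodule A E} (h : N.FG)
    (e : N ≃L[A] N') : N'.FG := by
  rw [← Module.Finite.iff_fg] at h ⊢
  exact Module.Finite.equiv e.toLinearEquiv

/-- The closed copy of `N` inside `P` is transported along `f`; its image is closed in `P'`, hence
in `E` since `P'` is closed. -/
theorem IsSubequivalent.congr {N N' P P' : Submodule A E}
    (h : IsSubequivalent N P) (e : N ≃L[A] N') (f : P ≃L[A] P')
    (hP' : IsClosed (P' : Set E)) : IsSubequivalent N' P' := by
  obtain ⟨Q, hQP, hQ, ⟨g⟩⟩ := h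
  let R : Submodule A P := Q.comap P.subtype
  let R' : Submodule A P' := R.map (f : P →ₗ[A] P')
  have hR : IsClosed (R : Set P) := hQ.preimage continuous_subtype_val
  have hR' : IsClosed (R' : Set P') := by
    have h1 : (R' : Set P') = f '' (R : Set P) := rfl
    rw [h1]
    exact f.toHomeomorph.isClosedMap _ hR
  have hval : IsClosed ((R'.map P'.subtype : Submodule A E) : Set E) :=
    hP'.isClosedEmbedding_subtypeVal.isClosedMap _ hR'
  refine ⟨R'.map P'.subtype, Submodule.map_subtype_le _ _, hval, ⟨e.symm.trans (g.trans ?_)⟩⟩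
  have hto : ∀ x (hx : x ∈ Q), (f ⟨x, hQP hx⟩ : E) ∈ R'.map P'.subtype := fun x hx =>
    ⟨f ⟨x, hQP hx⟩, ⟨⟨x, hQP hx⟩, hx, rfl⟩, rfl⟩
  have hfrom : ∀ y : R'.map P'.subtype, ∃ hy : (y : E) ∈ P', (f.symm ⟨y, hy⟩ : E) ∈ Q := by
    rintro ⟨_, _, ⟨x, hx, rfl⟩, rfl⟩
    refine ⟨(f x).2, ?_⟩
    have h1 : f.symm (f x) = x := f.symm_apply_apply x
    exact (congrArg Subtype.val h1).symm ▸ hx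
  let u : Q →L[A] R'.map P'.subtype :=
    (P'.subtypeL ∘L (f : P →L[A] P') ∘L Q.subtypeL.codRestrict P fun x => hQP x.2).codRestrict _
      fun x => hto x x.2
  let v : R'.map P'.subtype →L[A] Q :=
    (P.subtypeL ∘L (f.symm : P' →L[A] P) ∘L
      (R'.map P'.subtype).subtypeL.codRestrict P' fun y => (hfrom y).1).codRestrict _
      fun y => (hfrom y).2
  refine .equivOfInverse u v (fun x => Subtype.ext ?_) fun y => Subtype.ext ?_
  · have h1 := congrArg (fun z : P => (z : E)) (f.symm_apply_apply ⟨x, hQP x.2⟩)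
    exact h1
  · have h1 := congrArg (fun z : P' => (z : E)) (f.apply_symm_apply ⟨y, (hfrom y).1⟩)
    exact h1

end Subequivalent

/-! ### Adjointable outer inverses of semi-Fredholm operators -/

namespace StandardModule

open ContinuousLinearMap CStarModule

variable {A : Type*} [CStarAlgebra A] [PartialOrder A] [StarOrderedRing A]
  {F : AdjointableOp A (StandardModule A)} {M₁ N₁ M₂ N₂ : Submodule A (StandardModule A)}

/-- If `N₁` is finitely generated, the outer inverse can be chosen adjointable. -/
theorem _root_.IsDiagonalDecomposition.exists_adjointable_outer_inverse_of_fg_left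
    (h : IsDiagonalDecomposition F M₁ N₁ M₂ N₂) (hN : N₁.FG) :
    ∃ G G' : StandardModule A →L[A] StandardModule A, AreAdjoint G G' ∧ G * F.toCLM * G = G ∧
      Nonempty ((G * F.toCLM).ker ≃L[A] N₁) ∧ Nonempty (G.ker ≃L[A] N₂) := by
  obtain ⟨G, hG, hG₁, hG₂⟩ := h.exists_outer_inverse
  obtain ⟨p, p', hp, hpp, hpN⟩ := exists_adjointable_idempotent hN h.isClosed_N₁
  have hF : AreAdjoint F.toCLM F.adjCLM := F.inner_left
  set f := F.toCLM
  obtain ⟨r, hr⟩ : ∃ r, r = 1 - p := ⟨_, rfl⟩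
  have hrr : r * r = r := hr ▸ IsIdempotentElem.one_sub hpp
  have hrker : r.ker = N₁ := by rw [hr, ← hpN, range_eq_ker_one_sub hpp]
  have hadj : AreAdjoint r (1 - p') := hr ▸ AreAdjoint.one.sub hp
  -- `r` and `G f` are idempotents with the same kernel `N₁`, so each absorbs the other.
  have hrP : r * (G * f) = r := by
    ext1 x
    have h1 : x - G (f x) ∈ r.ker := by
      rw [hrker, ← hG₁]
      change G (f (x - G (f x))) = 0
      have h0 : G (f (G (f x))) = G (f x) := apply_eq_of_mul_eq hG (f x)
      rw [map_sub, map_sub, h0, sub_self]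
    have h2 : r (x - G (f x)) = 0 := h1
    rw [map_sub, sub_eq_zero] at h2
    exact h2.symm
  have hPr : G * f * r = G * f := by
    have h1 : G * f * p = 0 := by
      ext1 x
      have h2 : p x ∈ (G * f).ker := by
        rw [hG₁, ← hpN]
        exact ⟨x, rfl⟩
      exact h2
    rw [hr, mul_sub, mul_one, h1, sub_zero]
  have hTinner : f * r * (r * G) * (f * r) = f * r := by
    calc f * r * (r * G) * (f * r) = f * (r * r) * (G * f * r) := by noncomm_ring
      _ = f * (r * (G * f)) := by rw [hrr, hPr, mul_assoc]
      _ = f * r := by rw [hrP]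
  have hclosed : IsClosed ((f * r).range : Set (StandardModule A)) := by
    have h1 : (f * r).range = (f * r * (r * G)).range := by
      refine le_antisymm ?_ ?_
      · rintro _ ⟨x, rfl⟩
        exact ⟨(f * r) x, apply_eq_of_mul_eq hTinner x⟩
      · rintro _ ⟨x, rfl⟩
        exact ⟨(r * G) x, rfl⟩
    rw [h1]
    exact isClosed_range_of_idempotent (by rw [← mul_assoc, hTinner])
  obtain ⟨S, S', hS, hTS, -⟩ := (hF.mul hadj).exists_inner_inverse hclosed
  -- `r G` is a left inverse of `f r` on the range of `r`, so it cancels in `f r S f r = f r`.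
  have hrST : r * S * (f * r) = r := by
    have h1 : r * G * (f * r) = r := by rw [mul_assoc, ← mul_assoc G, hPr, hrP]
    calc r * S * (f * r) = r * G * (f * r) * S * (f * r) := by rw [h1]
      _ = r * G * (f * r * S * (f * r)) := by noncomm_ring
      _ = r := by rw [hTS, h1]
  have houter : r * S * f * (r * S) = r * S := by
    calc r * S * f * (r * S) = r * S * (f * r) * S := by noncomm_ring
      _ = r * S := by rw [hrST]
  refine ⟨r * S, _, hadj.mul hS, houter, ?_, ?_⟩
  · rw [← hrker]
    refine nonempty_ker_equiv_ker (e := r * S * f) ?_ ?_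
    · rw [mul_assoc, hrST]
    · rw [← mul_assoc, ← mul_assoc, hrr]
  -- The idempotents `f r S` and `f r G` have the same range, and their kernels are those of `r S`
  -- and `G`.
  · have hG' : G * (f * r) * G = G := by rw [← mul_assoc, hPr, hG]
    have h1 : (f * (r * S)).ker = (r * S).ker := ker_mul_eq_of_outer_inverse houter
    have h2 : (f * r * G).ker = G.ker := ker_mul_eq_of_outer_inverse hG'
    rw [← h1, ← hG₂, ← h2]
    refine nonempty_ker_equiv_ker ?_ ?_
    · calc f * (r * S) * (f * r * G) = f * (r * S * (f * r)) * G := by noncomm_ring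
        _ = f * r * G := by rw [hrST]
    · calc f * r * G * (f * (r * S)) = f * (r * (G * f)) * (r * S) := by noncomm_ring
        _ = f * (r * r) * S := by rw [hrP]; noncomm_ring
        _ = f * (r * S) := by rw [hrr, mul_assoc]

/-- If `N₂` is finitely generated, the outer inverse can be chosen adjointable. -/
theorem _root_.IsDiagonalDecomposition.exists_adjointable_outer_inverse_of_fg_right
    (h : IsDiagonalDecomposition F M₁ N₁ M₂ N₂) (hN : N₂.FG) :
    ∃ G G' : StandardModule A →L[A] StandardModule A, AreAdjoint G G' ∧ G * F.toCLM * G = G ∧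
      Nonempty ((G * F.toCLM).ker ≃L[A] N₁) ∧ Nonempty (G.ker ≃L[A] N₂) := by
  obtain ⟨G, hG, hG₁, hG₂⟩ := h.exists_outer_inverse
  obtain ⟨p, p', hp, hpp, hpN⟩ := exists_adjointable_idempotent hN h.isClosed_N₂
  have hF : AreAdjoint F.toCLM F.adjCLM := F.inner_left
  set f := F.toCLM
  obtain ⟨r, hr⟩ : ∃ r, r = 1 - p := ⟨_, rfl⟩
  have hrr : r * r = r := hr ▸ IsIdempotentElem.one_sub hpp
  have hrker : r.ker = N₂ := by rw [hr, ← hpN, range_eq_ker_one_sub hpp]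
  have hadj : AreAdjoint r (1 - p') := hr ▸ AreAdjoint.one.sub hp
  -- `1 - f G` maps into `N₂ = ker r`. Hence `r f` has the range of `r`, which is closed.
  have hTG : r * f * G = r := by
    ext1 x
    have h1 : x - f (G x) ∈ r.ker := by
      rw [hrker, ← hG₂]
      change G (x - f (G x)) = 0
      have h0 : G (f (G x)) = G x := apply_eq_of_mul_eq hG x
      rw [map_sub, h0, sub_self]
    have h2 : r (x - f (G x)) = 0 := h1
    rw [map_sub, sub_eq_zero] at h2
    exact h2.symm
  have hclosed : IsClosed ((r * f).range : Set (StandardModule A)) := by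
    have h1 : (r * f).range = r.range := by
      refine le_antisymm ?_ ?_
      · rintro _ ⟨x, rfl⟩
        exact ⟨f x, rfl⟩
      · rintro _ ⟨x, rfl⟩
        exact ⟨G x, apply_eq_of_mul_eq hTG x⟩
    rw [h1]
    exact isClosed_range_of_idempotent hrr
  obtain ⟨S, S', hS, hTS, -⟩ := (hadj.mul hF).exists_inner_inverse hclosed
  have hTSr : r * f * S * r = r := by
    calc r * f * S * r = r * f * S * (r * f) * G := by rw [mul_assoc _ (r * f), hTG]
      _ = r := by rw [hTS, hTG]
  have houter : S * r * f * (S * r) = S * r := by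
    calc S * r * f * (S * r) = S * (r * f * S * r) := by noncomm_ring
      _ = S * r := by rw [hTSr]
  have hker : (S * r).ker = N₂ := by
    rw [← hrker]
    refine le_antisymm (fun x hx => ?_) fun x hx => ?_
    · have hx' : S (r x) = 0 := hx
      have h1 : r (f (S (r x))) = r x := apply_eq_of_mul_eq hTSr x
      rw [hx', map_zero, map_zero] at h1
      exact h1.symm
    · have hx' : r x = 0 := hx
      change S (r x) = 0
      rw [hx', map_zero]
  have hmem : ∀ {H : StandardModule A →L[A] StandardModule A}, H.ker = N₂ →
      ∀ x, x ∈ (H * f).ker ↔ f x ∈ N₂ := fun hH x => by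
    rw [← hH]
    rfl
  refine ⟨S * r, _, hS.mul hadj, houter, ?_, ?_⟩
  -- Both `ker (S r f)` and `ker (G f)` are the preimage of `N₂` under `f`.
  · have h1 : (S * r * f).ker = N₁ := by
      rw [← hG₁]
      ext x
      rw [hmem hker, hmem hG₂]
    rw [h1]
    exact ⟨.refl A N₁⟩
  · rw [hker]
    exact ⟨.refl A N₂⟩

/-- If `N₁` or `N₂` is finitely generated, then `F⋆` has a diagonal decomposition with isomorphic
complements in opposite order. -/
theorem _root_.IsDiagonalDecomposition.exists_adjoint
    (h : IsDiagonalDecomposition F M₁ N₁ M₂ N₂) (hN : N₁.FG ∨ N₂.FG) :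
    ∃ M₁' N₁' M₂' N₂' : Submodule A (StandardModule A),
      IsDiagonalDecomposition F.adjoint M₁' N₁' M₂' N₂' ∧
      Nonempty (N₂ ≃L[A] N₁') ∧ Nonempty (N₁ ≃L[A] N₂') := by
  obtain ⟨G, G', hG, hGF, ⟨e₁⟩, ⟨e₂⟩⟩ := hN.elim
    h.exists_adjointable_outer_inverse_of_fg_left h.exists_adjointable_outer_inverse_of_fg_right
  obtain ⟨M₁', N₁', M₂', N₂', h', ⟨f₁⟩, ⟨f₂⟩⟩ := exists_isDiagonalDecomposition_adjoint F hG hGF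
  exact ⟨M₁', N₁', M₂', N₂', h', ⟨e₂.symm.trans f₁⟩, ⟨e₁.symm.trans f₂⟩⟩

end StandardModule

section Classes

variable {A : Type*} [CStarAlgebra A] [PartialOrder A] [StarOrderedRing A]
  {F : AdjointableOp A (StandardModule A)}

theorem adjoint_mem_MPhiMinus (h : F ∈ MPhiPlus A (StandardModule A)) :
    F.adjoint ∈ MPhiMinus A (StandardModule A) := by
  obtain ⟨M₁, N₁, M₂, N₂, hd, h₁⟩ := h
  obtain ⟨M₁', N₁', M₂', N₂', hd', ⟨e₁⟩, ⟨e₂⟩⟩ := hd.exists_adjoint (.inl h₁)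
  exact ⟨M₁', N₁', M₂', N₂', hd', h₁.of_continuousLinearEquiv e₂⟩

theorem adjoint_mem_MPhiPlus (h : F ∈ MPhiMinus A (StandardModule A)) :
    F.adjoint ∈ MPhiPlus A (StandardModule A) := by
  obtain ⟨M₁, N₁, M₂, N₂, hd, h₂⟩ := h
  obtain ⟨M₁', N₁', M₂', N₂', hd', ⟨e₁⟩, ⟨e₂⟩⟩ := hd.exists_adjoint (.inr h₂)
  exact ⟨M₁', N₁', M₂', N₂', hd', h₂.of_continuousLinearEquiv e₁⟩

theorem adjoint_mem_MPhi (h : F ∈ MPhi A (StandardModule A)) :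
    F.adjoint ∈ MPhi A (StandardModule A) := by
  obtain ⟨M₁, N₁, M₂, N₂, hd, h₁, h₂⟩ := h
  obtain ⟨M₁', N₁', M₂', N₂', hd', ⟨e₁⟩, ⟨e₂⟩⟩ := hd.exists_adjoint (.inl h₁)
  exact ⟨M₁', N₁', M₂', N₂', hd', h₂.of_continuousLinearEquiv e₁, h₁.of_continuousLinearEquiv e₂⟩

theorem adjoint_mem_MPhiMinusPlusPrime (h : F ∈ MPhiPlusMinusPrime A (StandardModule A)) :
    F.adjoint ∈ MPhiMinusPlusPrime A (StandardModule A) := by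
  obtain ⟨hF, M₁, N₁, M₂, N₂, hd, h₁, hle⟩ := h
  obtain ⟨M₁', N₁', M₂', N₂', hd', ⟨e₁⟩, ⟨e₂⟩⟩ := hd.exists_adjoint (.inl h₁)
  exact ⟨adjoint_mem_MPhiMinus hF, M₁', N₁', M₂', N₂', hd', h₁.of_continuousLinearEquiv e₂,
    hle.congr e₂ e₁ hd'.isClosed_N₁⟩

theorem adjoint_mem_MPhiPlusMinusPrime (h : F ∈ MPhiMinusPlusPrime A (StandardModule A)) :
    F.adjoint ∈ MPhiPlusMinusPrime A (StandardModule A) := by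
  obtain ⟨hF, M₁, N₁, M₂, N₂, hd, h₂, hle⟩ := h
  obtain ⟨M₁', N₁', M₂', N₂', hd', ⟨e₁⟩, ⟨e₂⟩⟩ := hd.exists_adjoint (.inr h₂)
  exact ⟨adjoint_mem_MPhiPlus hF, M₁', N₁', M₂', N₂', hd', h₂.of_continuousLinearEquiv e₁,
    hle.congr e₁ e₂ hd'.isClosed_N₂⟩

theorem adjoint_mem_MPhiMinusPlusTilde (h : F ∈ MPhiPlusMinusTilde A (StandardModule A)) :
    F.adjoint ∈ MPhiMinusPlusTilde A (StandardModule A) := by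
  obtain ⟨hF, M₁, N₁, M₂, N₂, hd, h₁, h₂, hle⟩ := h
  obtain ⟨M₁', N₁', M₂', N₂', hd', ⟨e₁⟩, ⟨e₂⟩⟩ := hd.exists_adjoint (.inl h₁)
  exact ⟨adjoint_mem_MPhi hF, M₁', N₁', M₂', N₂', hd', h₂.of_continuousLinearEquiv e₁,
    h₁.of_continuousLinearEquiv e₂, hle.congr e₂ e₁ hd'.isClosed_N₁⟩

theorem adjoint_mem_MPhiPlusMinusTilde (h : F ∈ MPhiMinusPlusTilde A (StandardModule A)) :
    F.adjoint ∈ MPhiPlusMinusTilde A (StandardModule A) := by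
  obtain ⟨hF, M₁, N₁, M₂, N₂, hd, h₁, h₂, hle⟩ := h
  obtain ⟨M₁', N₁', M₂', N₂', hd', ⟨e₁⟩, ⟨e₂⟩⟩ := hd.exists_adjoint (.inl h₁)
  exact ⟨adjoint_mem_MPhi hF, M₁', N₁', M₂', N₂', hd', h₂.of_continuousLinearEquiv e₁,
    h₁.of_continuousLinearEquiv e₂, hle.congr e₁ e₂ hd'.isClosed_N₂⟩

end Classes

theorem proposition5p11 {A : Type*} [CStarAlgebra A] [PartialOrder A] [StarOrderedRing A]
    (F : AdjointableOp A (StandardModule A)) :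
    (F ∈ MPhiPlusMinusPrime A (StandardModule A) ↔
      F.adjoint ∈ MPhiMinusPlusPrime A (StandardModule A)) ∧
    (F ∈ MPhiPlusMinusTilde A (StandardModule A) ↔
      F.adjoint ∈ MPhiMinusPlusTilde A (StandardModule A)) ∧
    (F ∈ MPhiPlusMinus A (StandardModule A) ↔
      F.adjoint ∈ MPhiMinusPlus A (StandardModule A)) := by
  -- `F⋆⋆ = F` holds definitionally, so the converses are the mirrored lemmas applied to `F⋆`.
  refine ⟨⟨adjoint_mem_MPhiMinusPlusPrime, fun h => adjoint_mem_MPhiPlusMinusPrime h⟩,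
    ⟨adjoint_mem_MPhiMinusPlusTilde, fun h => adjoint_mem_MPhiPlusMinusTilde h⟩, ?_, ?_⟩
  · rintro (h | ⟨h, h'⟩)
    · exact .inl (adjoint_mem_MPhiMinusPlusTilde h)
    · exact .inr ⟨adjoint_mem_MPhiMinus h, fun h'' => h' (adjoint_mem_MPhi h'')⟩
  · rintro (h | ⟨h, h'⟩)
    · exact .inl (adjoint_mem_MPhiPlusMinusTilde h)
    · exact .inr ⟨adjoint_mem_MPhiPlus h, fun h'' => h' (adjoint_mem_MPhi h'')⟩
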